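/- Let $d\ge 2$, let $H_1,\dots,H_d$ be Hilbert spaces (all real or all complex), let $\mathbf H=H_1\otimes\cdots\otimes H_d$ be their Hilbert space tensor product, and let $t\subset\{1,\dots,d\}$ with $0<|t|<d$, so that $\mathbf H\cong H_t\otimes H_{t^c}$ with $H_t=\bigotimes_{\mu\in t}H_\mu$ and $H_{t^c}=\bigotimes_{\nu\notin t}H_\nu$. The $t$-rank $\operatorname{rank}^{(t)}(\mathbf v)$ of $\mathbf v\in\mathbf H$ is the rank of the Hilbert--Schmidt operator between $H_t$ and $H_{t^c}$ associated with $\mathbf v$. For $\mathbf u\in\mathbf H$ put $$\tau_r^{(t)}(\mathbf u)=\inf_{\operatorname{rank}^{(t)}(\mathbf v)\le r}\|\mathbf u-\mathbf v\|,\qquad \theta_1^{(t)}(\mathbf u)=\sup_{\operatorname{rank}^{(t)}(\mathbf v)=1,\ \|\mathbf v\|=1}\Big|\Big\langle \frac{\mathbf u}{\|\mathbf u\|},\mathbf v\Big\rangle\Big|\quad(\mathbf u\ne 0).$$ Let $\mathbf A$ be a bounded self-adjoint operator on $\mathbf H$ with $\lambda_1\|\mathbf v\|^2\le\langle\mathbf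 v,\mathbf A\mathbf v\rangle\le\Gamma\|\mathbf v\|^2$ for all $\mathbf v\in\mathbf H$, where $\lambda_1$ is a simple eigenvalue of $\mathbf A$ and the rest of the spectrum of $\mathbf A$ is contained in $[\lambda_2,\Gamma]$ with $\lambda_1<\lambda_2<\Gamma$. Let $\mathbf u\ne 0$ be an eigenvector of $\mathbf A$ for $\lambda_1$. Assume that $$\mathbf A=\sum_{i=1}^{r_{\mathbf A}}A_i\otimes B_i$$ with bounded operators $A_i$ on $H_t$ and $B_i$ on $H_{t^c}$. Put $$\Delta=\frac{\lambda_2-\lambda_1}{\Gamma-\lambda_1},\qquad q=\frac{1-\Delta}{1+\Delta},$$ and $R=r_{\mathbf A}+1$; if one of the operators $A_i$ or $B_i$ is the identity, one may also take $R=r_{\mathbf A}$. Assume $q^2R<1$. Then $$\big(\theta_1^{(t)}(\mathbf u)\big)^2\ \ge\ \frac12\Big(\frac1R\Big)^{\left\lceil\frac{-\ln 2}{\ln(q^2R)}\right\rceil},$$ and consequently, for every integer $r\ge 1$, $$\tau_r^{(t)}(\mathbf u)\ \le\ \sqrt2\,R^{\frac12\left\lceil\frac{-\ln 2}{\ln(q^2R)}\right\rceil}\,\frac{\|\mathbf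 u\|}{q}\,\Big(\frac1r\Big)^{\left|\frac{\ln q}{\ln R}\right|}$$ (if $R=1$, the last exponent is read as $0$). -/

import Mathlib

open scoped TensorProduct ComplexConjugate

noncomputable section

/-- The algebraic tensor product of a family of spaces. It is a copy of Mathlib's `PiTensorProduct`
(which already carries the projective seminorm) and will carry the inner product
`⟪⨂ xᵢ, ⨂ yᵢ⟫ = ∏ᵢ ⟪xᵢ, yᵢ⟫` instead. -/
def AlgTensor (𝕜 : Type*) [RCLike 𝕜] {ι : Type*} (H : ι → Type*)
    [∀ i, NormedAddCommGroup (H i)] [∀ i, InnerProductSpace 𝕜 (H i)] : Type _ :=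
  PiTensorProduct 𝕜 H

namespace AlgTensor

variable {𝕜 : Type*} [RCLike 𝕜] {ι : Type*} {H : ι → Type*}
  [∀ i, NormedAddCommGroup (H i)] [∀ i, InnerProductSpace 𝕜 (H i)]

instance instAddCommGroup : AddCommGroup (AlgTensor 𝕜 H) :=
  inferInstanceAs (AddCommGroup (PiTensorProduct 𝕜 H))

instance instModule : Module 𝕜 (AlgTensor 𝕜 H) :=
  inferInstanceAs (Module 𝕜 (PiTensorProduct 𝕜 H))

variable (𝕜) in
/-- The elementary tensor `⨂ xᵢ`. -/
def tprod (x : ∀ i, H i) : AlgTensor 𝕜 H := PiTensorProduct.tprod 𝕜 x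

theorem induction_on {p : AlgTensor 𝕜 H → Prop} (z : AlgTensor 𝕜 H)
    (hs : ∀ (r : 𝕜) (f : ∀ i, H i), p (r • tprod 𝕜 f))
    (ha : ∀ x y, p x → p y → p (x + y)) : p z :=
  PiTensorProduct.induction_on (R := 𝕜) (s := H) z hs ha

theorem hom_ext {f g : AlgTensor 𝕜 H →ₗ[𝕜] 𝕜} (h : ∀ y, f (tprod 𝕜 y) = g (tprod 𝕜 y)) :
    f = g :=
  PiTensorProduct.ext (R := 𝕜) (s := H) (MultilinearMap.ext h)

open scoped ComplexOrder in
theorem posSemidef_prod {n : Type*} [Finite n] (v : n → ∀ i, H i) (s : Finset ι) :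
    (Matrix.of fun k l => ∏ i ∈ s, inner 𝕜 (v k i) (v l i)).PosSemidef := by
  classical
  induction s using Finset.induction_on with
  | empty =>
    convert! Matrix.posSemidef_gram 𝕜 (fun _ : n => (1 : 𝕜)) using 1
    ext k l
    simp
  | insert i s hi ih =>
    convert! (Matrix.posSemidef_gram 𝕜 (fun k => v k i)).hadamard ih using 1
    ext k l
    simp [hi]

variable [Fintype ι]

/-- The linear functional `⨂ yᵢ ↦ ∏ᵢ ⟪xᵢ, yᵢ⟫`. -/
def innerElem (x : ∀ i, H i) : AlgTensor 𝕜 H →ₗ[𝕜] 𝕜 :=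
  PiTensorProduct.lift ((MultilinearMap.mkPiAlgebra 𝕜 ι 𝕜).compLinearMap
    fun i => innerₛₗ 𝕜 (x i))

theorem innerElem_tprod (x y : ∀ i, H i) :
    innerElem x (tprod 𝕜 y) = ∏ i, inner 𝕜 (x i) (y i) := by
  exact (PiTensorProduct.lift.tprod (R := 𝕜) (s := H) y).trans (by simp)

theorem prod_inner_update [DecidableEq ι] (x y : ∀ i, H i) (i : ι) (m : H i) :
    ∏ j, inner 𝕜 (Function.update x i m j) (y j) =
      inner 𝕜 m (y i) * ∏ j ∈ Finset.univ.erase i, inner 𝕜 (x j) (y j) := by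
  rw [← Finset.mul_prod_erase _ _ (Finset.mem_univ i)]
  congr 1
  · simp
  · refine Finset.prod_congr rfl fun j hj => ?_
    rw [Function.update_of_ne (Finset.ne_of_mem_erase hj)]

/-- The inner product as an additive map in its first argument, determined by
`c • ⨂ xᵢ ↦ conj c * ∏ᵢ ⟪xᵢ, ·⟫`. -/
def innerHom : AlgTensor 𝕜 H →+ (AlgTensor 𝕜 H →ₗ[𝕜] 𝕜) :=
  PiTensorProduct.liftAddHom (R := 𝕜) (s := H) (fun p => conj p.1 • innerElem p.2)
    (by
      intro r f i hf
      refine hom_ext fun y => ?_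
      have : ∏ j, inner 𝕜 (f j) (y j) = 0 :=
        Finset.prod_eq_zero (Finset.mem_univ i) (by simp [hf])
      simp [innerElem_tprod, this])
    (by intro f; simp)
    (by
      intro _ r f i m₁ m₂
      refine hom_ext fun y => ?_
      simp only [LinearMap.add_apply, LinearMap.smul_apply, innerElem_tprod, prod_inner_update,
        inner_add_left, smul_eq_mul]
      ring)
    (by intro r r' f; simp [add_smul])
    (by
      intro _ r f i r'
      refine hom_ext fun y => ?_
      simp only [LinearMap.smul_apply, innerElem_tprod, prod_inner_update, inner_smul_left,
        smul_eq_mul, map_mul]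
      rw [← Finset.mul_prod_erase Finset.univ (fun j => inner 𝕜 (f j) (y j)) (Finset.mem_univ i)]
      ring)

theorem innerHom_smul_tprod (r : 𝕜) (x : ∀ i, H i) :
    innerHom (r • tprod 𝕜 x) = conj r • innerElem x := by
  have h : r • tprod 𝕜 x = PiTensorProduct.tprodCoeff 𝕜 r x :=
    (PiTensorProduct.tprodCoeff_eq_smul_tprod r x).symm
  rw [h]
  rfl

theorem innerHom_tprod (x : ∀ i, H i) : innerHom (tprod 𝕜 x) = innerElem x := by
  simpa using innerHom_smul_tprod (1 : 𝕜) x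

theorem innerHom_smul (r : 𝕜) (x : AlgTensor 𝕜 H) :
    innerHom (r • x) = conj r • innerHom x := by
  induction x using induction_on with
  | hs c f => rw [smul_smul, innerHom_smul_tprod, innerHom_smul_tprod, smul_smul, map_mul]
  | ha x y hx hy => rw [smul_add, map_add, map_add, hx, hy, smul_add]

theorem innerHom_conj_symm (x y : AlgTensor 𝕜 H) :
    conj (innerHom y x) = innerHom x y := by
  induction x using induction_on with
  | ha x x' hx hx' => simp [hx, hx']
  | hs r f =>
    induction y using induction_on with
    | ha y y' hy hy' =>
      rw [map_add, LinearMap.add_apply, map_add, hy, hy', map_add]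
    | hs c g =>
      simp only [innerHom_smul_tprod, map_smul, LinearMap.smul_apply, innerElem_tprod,
        smul_eq_mul, map_mul, map_prod, inner_conj_symm, RCLike.conj_conj]
      ring

open scoped ComplexOrder in
theorem innerHom_self_nonneg (x : AlgTensor 𝕜 H) : 0 ≤ RCLike.re (innerHom x x) := by
  have hx : x ∈ Submodule.span 𝕜 (Set.range (tprod 𝕜 : (∀ i, H i) → AlgTensor 𝕜 H)) := by
    have h : Submodule.span 𝕜 (Set.range (tprod 𝕜 : (∀ i, H i) → AlgTensor 𝕜 H)) = ⊤ :=
      PiTensorProduct.span_tprod_eq_top (R := 𝕜) (s := H)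
    rw [h]
    trivial
  obtain ⟨n, c, w, rfl⟩ := Submodule.mem_span_set'.1 hx
  choose v hv using fun k => (w k).2
  have hP := (posSemidef_prod (𝕜 := 𝕜) v Finset.univ).dotProduct_mulVec_nonneg c
  have hE : innerHom (∑ k, c k • (w k : AlgTensor 𝕜 H)) (∑ k, c k • (w k : AlgTensor 𝕜 H)) =
      star c ⬝ᵥ ((Matrix.of fun k l => ∏ i, inner 𝕜 (v k i) (v l i)).mulVec c) := by
    simp only [← hv, map_sum, LinearMap.sum_apply, innerHom_smul_tprod, LinearMap.smul_apply,
      map_smul, innerElem_tprod, dotProduct, Matrix.mulVec, Matrix.of_apply, smul_eq_mul,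
      Pi.star_apply, RCLike.star_def, Finset.mul_sum]
    rw [Finset.sum_comm]
    exact Finset.sum_congr rfl fun k _ => Finset.sum_congr rfl fun l _ => by ring
  rw [hE]
  exact (RCLike.nonneg_iff.1 hP).1

/-- The inner product on the algebraic tensor product. -/
@[reducible] def core : PreInnerProductSpace.Core 𝕜 (AlgTensor 𝕜 H) where
  inner x y := innerHom x y
  conj_inner_symm := innerHom_conj_symm
  re_inner_nonneg := innerHom_self_nonneg
  add_left x y z := by simp
  smul_left x y r := by simp [innerHom_smul]

instance instSeminormedAddCommGroup : SeminormedAddCommGroup (AlgTensor 𝕜 H) :=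
  @InnerProductSpace.Core.toSeminormedAddCommGroup 𝕜 _ _ _ _ core

instance instInnerProductSpace : InnerProductSpace 𝕜 (AlgTensor 𝕜 H) :=
  InnerProductSpace.ofCore core

theorem inner_tprod (x y : ∀ i, H i) :
    inner 𝕜 (tprod 𝕜 x) (tprod 𝕜 y) = ∏ i, inner 𝕜 (x i) (y i) := by
  change innerHom (tprod 𝕜 x) (tprod 𝕜 y) = _
  rw [innerHom_tprod, innerElem_tprod]

end AlgTensor

namespace AlgTensor

variable {𝕜 : Type*} [RCLike 𝕜] {ι : Type*} [DecidableEq ι] {H : ι → Type*}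
  [∀ i, NormedAddCommGroup (H i)] [∀ i, InnerProductSpace 𝕜 (H i)]

/-- The bilinear map on algebraic tensor products that merges a tensor over `t` with a tensor over
the complement of `t`, that is, `(⨂_{i ∈ t} xᵢ, ⨂_{i ∉ t} xᵢ) ↦ ⨂ᵢ xᵢ`. -/
def mergeAlg (t : Finset ι) :
    AlgTensor 𝕜 (fun i : {i // i ∈ t} => H i) →ₗ[𝕜]
      AlgTensor 𝕜 (fun i : {i // i ∉ t} => H i) →ₗ[𝕜] AlgTensor 𝕜 H :=
  TensorProduct.curry
    (((PiTensorProduct.reindex 𝕜 H (Equiv.sumCompl (· ∈ t)).symm).symm.toLinearMap).comp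
      (PiTensorProduct.tmulEquivDep 𝕜
        (fun s => H (Equiv.sumCompl (· ∈ t) s))).toLinearMap)

theorem mergeAlg_tprod (t : Finset ι) (x : ∀ i : {i // i ∈ t}, H i)
    (y : ∀ i : {i // i ∉ t}, H i) :
    mergeAlg t (tprod 𝕜 x) (tprod 𝕜 y) =
      tprod 𝕜 (fun i => if h : i ∈ t then x ⟨i, h⟩ else y ⟨i, h⟩) := by
  set z : ∀ i, H i := fun i => if h : i ∈ t then x ⟨i, h⟩ else y ⟨i, h⟩ with hz
  have h1 : PiTensorProduct.reindex 𝕜 H (Equiv.sumCompl (· ∈ t)).symm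
      (PiTensorProduct.tprod 𝕜 z) =
      PiTensorProduct.tprod 𝕜 fun s => z (Equiv.sumCompl (· ∈ t) s) :=
    PiTensorProduct.reindex_tprod (R := 𝕜) (s := H) _ _
  change (PiTensorProduct.reindex 𝕜 H (Equiv.sumCompl (· ∈ t)).symm).symm
    (PiTensorProduct.tmulEquivDep 𝕜 (fun s => H (Equiv.sumCompl (· ∈ t) s))
      (PiTensorProduct.tprod 𝕜 x ⊗ₜ PiTensorProduct.tprod 𝕜 y)) = PiTensorProduct.tprod 𝕜 z
  rw [LinearEquiv.symm_apply_eq, h1]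
  refine (PiTensorProduct.tmulEquivDep_apply 𝕜
    (fun s => H (Equiv.sumCompl (· ∈ t) s)) x y).trans ?_
  congr 1
  funext s
  rcases s with ⟨i, hi⟩ | ⟨i, hi⟩
  · simp [hz, hi]
  · simp [hz, hi]

variable [Fintype ι]

theorem inner_mergeAlg (t : Finset ι)
    (a a' : AlgTensor 𝕜 (fun i : {i // i ∈ t} => H i))
    (b b' : AlgTensor 𝕜 (fun i : {i // i ∉ t} => H i)) :
    inner 𝕜 (mergeAlg t a b) (mergeAlg t a' b') = inner 𝕜 a a' * inner 𝕜 b b' := by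
  induction a using induction_on with
  | ha a₁ a₂ h₁ h₂ =>
    simp only [map_add, LinearMap.add_apply, inner_add_left, h₁, h₂, add_mul]
  | hs r f =>
  induction a' using induction_on with
  | ha a₁ a₂ h₁ h₂ =>
    simp only [map_add, LinearMap.add_apply, inner_add_right, h₁, h₂, add_mul]
  | hs r' f' =>
  induction b using induction_on with
  | ha a₁ a₂ h₁ h₂ => simp only [map_add, inner_add_left, h₁, h₂, mul_add]
  | hs c g =>
  induction b' using induction_on with
  | ha a₁ a₂ h₁ h₂ => simp only [map_add, inner_add_right, h₁, h₂, mul_add]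
  | hs c' g' =>
  have key : ∏ i, inner 𝕜 (if h : i ∈ t then f ⟨i, h⟩ else g ⟨i, h⟩)
      (if h : i ∈ t then f' ⟨i, h⟩ else g' ⟨i, h⟩) =
      (∏ i, inner 𝕜 (f i) (f' i)) * ∏ i, inner 𝕜 (g i) (g' i) := by
    rw [← Fintype.prod_subtype_mul_prod_subtype (· ∈ t)]
    congr 1
    · refine Finset.prod_congr (by ext; simp) fun i _ => by rw [dif_pos i.2, dif_pos i.2]
    · exact Finset.prod_congr rfl fun i _ => by rw [dif_neg i.2, dif_neg i.2]
  simp only [map_smul, LinearMap.smul_apply, mergeAlg_tprod, inner_smul_left, inner_smul_right,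
    inner_tprod, key]
  ring

theorem norm_mergeAlg (t : Finset ι)
    (a : AlgTensor 𝕜 (fun i : {i // i ∈ t} => H i))
    (b : AlgTensor 𝕜 (fun i : {i // i ∉ t} => H i)) :
    ‖mergeAlg t a b‖ = ‖a‖ * ‖b‖ := by
  have h := inner_mergeAlg t a a b b
  simp only [inner_self_eq_norm_sq_to_K] at h
  have h' : ‖mergeAlg t a b‖ ^ 2 = (‖a‖ * ‖b‖) ^ 2 := by
    rw [mul_pow]
    exact_mod_cast h
  exact (pow_left_inj₀ (norm_nonneg _) (by positivity) two_ne_zero).1 h'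

end AlgTensor

/-- The tensor product Hilbert space `⨂ᵢ Hᵢ` of a finite family: the completion of the algebraic
tensor product for the inner product with `⟪⨂ xᵢ, ⨂ yᵢ⟫ = ∏ᵢ ⟪xᵢ, yᵢ⟫`. -/
abbrev HilbertTensor (𝕜 : Type*) [RCLike 𝕜] {ι : Type*} [Fintype ι] (H : ι → Type*)
    [∀ i, NormedAddCommGroup (H i)] [∀ i, InnerProductSpace 𝕜 (H i)] : Type _ :=
  UniformSpace.Completion (AlgTensor 𝕜 H)

namespace HilbertTensor

variable {𝕜 : Type*} [RCLike 𝕜] {ι : Type*} [Fintype ι] [DecidableEq ι] {H : ι → Type*}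
  [∀ i, NormedAddCommGroup (H i)] [∀ i, InnerProductSpace 𝕜 (H i)]

/-- The tensor product Hilbert space `H_t = ⨂_{i ∈ t} Hᵢ` of the factors in `t`. -/
abbrev InPart (𝕜 : Type*) [RCLike 𝕜] {ι : Type*} (H : ι → Type*)
    [∀ i, NormedAddCommGroup (H i)] [∀ i, InnerProductSpace 𝕜 (H i)] (t : Finset ι) : Type _ :=
  HilbertTensor 𝕜 (fun i : {i // i ∈ t} => H i)

/-- The tensor product Hilbert space `H_{tᶜ} = ⨂_{i ∉ t} Hᵢ` of the factors outside `t`. -/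
abbrev OutPart (𝕜 : Type*) [RCLike 𝕜] {ι : Type*} [Fintype ι] [DecidableEq ι] (H : ι → Type*)
    [∀ i, NormedAddCommGroup (H i)] [∀ i, InnerProductSpace 𝕜 (H i)] (t : Finset ι) : Type _ :=
  HilbertTensor 𝕜 (fun i : {i // i ∉ t} => H i)

/-- The merging map on algebraic tensor products, as a continuous bilinear map into the tensor
product Hilbert space. -/
def mergePre (t : Finset ι) :
    AlgTensor 𝕜 (fun i : {i // i ∈ t} => H i) →L[𝕜]
      AlgTensor 𝕜 (fun i : {i // i ∉ t} => H i) →L[𝕜] HilbertTensor 𝕜 H :=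
  LinearMap.mkContinuous₂
    ((AlgTensor.mergeAlg t).compr₂
      (UniformSpace.Completion.toComplL : AlgTensor 𝕜 H →L[𝕜] HilbertTensor 𝕜 H).toLinearMap) 1
    (fun a b => by
      rw [one_mul]
      exact ((UniformSpace.Completion.norm_coe _).trans
        (AlgTensor.norm_mergeAlg t a b)).le)

/-- The tensor product `(a, b) ↦ a ⊗ b` from `H_t × H_{tᶜ}` to `⨂ᵢ Hᵢ`: the continuous bilinear
extension of `(⨂_{i ∈ t} xᵢ, ⨂_{i ∉ t} xᵢ) ↦ ⨂ᵢ xᵢ`. -/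
def merge (t : Finset ι) : InPart 𝕜 H t →L[𝕜] OutPart 𝕜 H t →L[𝕜] HilbertTensor 𝕜 H :=
  (ContinuousLinearMap.extend
    (ContinuousLinearMap.extend (mergePre t) UniformSpace.Completion.toComplL).flip
    UniformSpace.Completion.toComplL).flip

theorem merge_coe (t : Finset ι) (a : AlgTensor 𝕜 (fun i : {i // i ∈ t} => H i))
    (b : AlgTensor 𝕜 (fun i : {i // i ∉ t} => H i)) :
    merge t (a : InPart 𝕜 H t) (b : OutPart 𝕜 H t) =
      ((AlgTensor.mergeAlg t a b : AlgTensor 𝕜 H) : HilbertTensor 𝕜 H) := by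
  have h1 := ContinuousLinearMap.extend_eq (mergePre (𝕜 := 𝕜) (H := H) t)
    (e := UniformSpace.Completion.toComplL (𝕜 := 𝕜))
    UniformSpace.Completion.denseRange_coe
    (UniformSpace.Completion.isUniformInducing_coe _) a
  have h2 := ContinuousLinearMap.extend_eq
    (ContinuousLinearMap.extend (mergePre (𝕜 := 𝕜) (H := H) t)
      (UniformSpace.Completion.toComplL (𝕜 := 𝕜))).flip
    (e := UniformSpace.Completion.toComplL (𝕜 := 𝕜))
    UniformSpace.Completion.denseRange_coe
    (UniformSpace.Completion.isUniformInducing_coe _) b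
  have h3 := congrArg (fun f => f (a : InPart 𝕜 H t)) h2
  have h4 := congrArg (fun f => f b) h1
  exact h3.trans h4

theorem inner_merge (t : Finset ι) (a a' : InPart 𝕜 H t) (b b' : OutPart 𝕜 H t) :
    inner 𝕜 (merge t a b) (merge t a' b') = inner 𝕜 a a' * inner 𝕜 b b' := by
  induction a, a' using UniformSpace.Completion.induction_on₂ with
  | hp => exact isClosed_eq (by fun_prop) (by fun_prop)
  | ih a a' =>
  induction b, b' using UniformSpace.Completion.induction_on₂ with
  | hp => exact isClosed_eq (by fun_prop) (by fun_prop)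
  | ih b b' =>
  simp only [merge_coe, UniformSpace.Completion.inner_coe]
  exact AlgTensor.inner_mergeAlg t a a' b b'

/-- The Hilbert-Schmidt operator from (the conjugate of) `H_t` to `H_{tᶜ}` associated with `u`,
that is, `⟪b, matricize t u a⟫ = ⟪a ⊗ b, u⟫`. For `u = x ⊗ y` it is `a ↦ ⟪a, x⟫ y`, see
`matricize_merge`. -/
def matricize (t : Finset ι) (u : HilbertTensor 𝕜 H) : InPart 𝕜 H t →ₗ⋆[𝕜] OutPart 𝕜 H t where
  toFun a := ContinuousLinearMap.adjoint (merge t a) u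
  map_add' a a' := by simp
  map_smul' c a := by
    rw [map_smul, map_smulₛₗ]
    rfl

theorem matricize_merge (t : Finset ι) (x a : InPart 𝕜 H t) (y : OutPart 𝕜 H t) :
    matricize t (merge t x y) a = inner 𝕜 a x • y := by
  refine ext_inner_left 𝕜 fun b => ?_
  have h : inner 𝕜 b (matricize t (merge t x y) a) = inner 𝕜 (merge t a b) (merge t x y) :=
    ContinuousLinearMap.adjoint_inner_right (merge t a) b (merge t x y)
  rw [h, inner_smul_right, inner_merge]

/-- The `t`-rank of `u`: the rank (dimension of the range) of the associated Hilbert-Schmidt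
operator, `⊤` if infinite. -/
def tRank (t : Finset ι) (u : HilbertTensor 𝕜 H) : ℕ∞ :=
  Cardinal.toENat (Module.rank 𝕜 (LinearMap.range (matricize t u)))

/-- The error `τ_r^{(t)}(u)` of best approximation of `u` by tensors of `t`-rank at most `r`. -/
def tau (t : Finset ι) (r : ℕ) (u : HilbertTensor 𝕜 H) : ℝ :=
  ⨅ v : {v : HilbertTensor 𝕜 H // tRank t v ≤ r}, ‖u - v‖

/-- The maximal overlap `θ₁^{(t)}(u)` of the normalized tensor `u / ‖u‖` with normalized tensors of
`t`-rank one. -/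
def theta (t : Finset ι) (u : HilbertTensor 𝕜 H) : ℝ :=
  ⨆ v : {v : HilbertTensor 𝕜 H // tRank t v = 1 ∧ ‖v‖ = 1},
    ‖inner 𝕜 (((‖u‖⁻¹ : ℝ) : 𝕜) • u) (v : HilbertTensor 𝕜 H)‖

/-- `A = ∑ᵢ Sᵢ ⊗ Tᵢ` with bounded operators `Sᵢ` on `H_t` and `Tᵢ` on `H_{tᶜ}`. Since the tensors
`a ⊗ b` span a dense subspace and `A` is bounded, this identity on them determines `A`. -/
def IsTensorSum (t : Finset ι) (A : HilbertTensor 𝕜 H →L[𝕜] HilbertTensor 𝕜 H) {n : ℕ}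
    (S : Fin n → (InPart 𝕜 H t →L[𝕜] InPart 𝕜 H t))
    (T : Fin n → (OutPart 𝕜 H t →L[𝕜] OutPart 𝕜 H t)) : Prop :=
  ∀ (a : InPart 𝕜 H t) (b : OutPart 𝕜 H t),
    A (merge t a b) = ∑ i, merge t (S i a) (T i b)

end HilbertTensor

end

/-! Put `e = u / ‖u‖`. The operator `B = 1 - α (A - λ₁)` with `α = 2 / (λ₂ + Γ - 2 λ₁)` fixes `e`,
contracts the orthogonal complement of `e` by the factor `q`, and is a sum of `R` elementary
operators. Let `v = a ⊗ b` be a unit vector with overlap `c = ⟪e, v⟫`. Then `B^k v` is a sum of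
`R^k` elementary tensors, still has overlap `c` with `e`, and lies within `q^k` of `c e`
(`iterate_contraction`).

Let `θ` be the supremum of `|c|`. A sum of `n` elementary tensors has normalized overlap at most `√n
θ` (`IsMergeSum.norm_inner_sq_le`), so `|c|² ≤ R^k θ² (|c|² + q^(2k))`. Passing to the supremum and
dividing by `θ²` gives `1 ≤ R^k θ² + (q² R)^k`; any `k` with `(q² R)^k ≤ 1/2` then bounds `θ` from
below. Moreover `(‖u‖ / c) B^k v` approximates `u` with error at most `q^k ‖u‖ / |c|`; letting `|c|`
tend to `θ` and taking the largest `k` with `R^k ≤ r` bounds `τ_r`. Neither supremum nor infimum has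
to be attained.

The contraction needs `A ≥ λ₂` on the complement of `e` as a bound on forms. It is derived from the
gap in the spectrum without spectral calculus (`le_re_inner_of_inner_eigenvector_eq_zero`). -/

/-! ### Symmetric operators: from invertibility to bounds on quadratic forms -/

section SelfAdjoint

variable {𝕜 E : Type*} [RCLike 𝕜] [NormedAddCommGroup E] [InnerProductSpace 𝕜 E]

theorem re_inner_symm_apply {Q : E →L[𝕜] E} (hQ : (Q : E →ₗ[𝕜] E).IsSymmetric) (v w : E) :
    RCLike.re (inner 𝕜 w (Q v)) = RCLike.re (inner 𝕜 v (Q w)) := by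
  have h : inner 𝕜 (Q w) v = inner 𝕜 w (Q v) := hQ w v
  rw [← h, inner_re_symm]

/-- The Cauchy-Schwarz inequality for the form of a positive operator. -/
theorem sq_re_inner_le_of_nonneg {Q : E →L[𝕜] E} (hQ : (Q : E →ₗ[𝕜] E).IsSymmetric)
    (h0 : ∀ v, 0 ≤ RCLike.re (inner 𝕜 v (Q v))) (v w : E) :
    RCLike.re (inner 𝕜 w (Q v)) ^ 2 ≤
      RCLike.re (inner 𝕜 w (Q w)) * RCLike.re (inner 𝕜 v (Q v)) := by
  -- The form at `v + s w` is a nonnegative quadratic polynomial in the real variable `s`.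
  have h := discrim_le_zero (a := RCLike.re (inner 𝕜 w (Q w)))
    (b := 2 * RCLike.re (inner 𝕜 w (Q v))) (c := RCLike.re (inner 𝕜 v (Q v))) (fun s => by
      have h1 := h0 (v + (s : 𝕜) • w)
      have h2 := re_inner_symm_apply hQ w v
      simp only [map_add, map_smul, inner_add_left, inner_add_right, inner_smul_left,
        inner_smul_right, RCLike.conj_ofReal, RCLike.re_ofReal_mul] at h1
      rw [h2] at h1
      linarith)
  unfold discrim at h
  linarith

/-- An invertible positive operator is coercive. -/
theorem exists_coercive_of_isUnit {Q : E →L[𝕜] E} (hQ : (Q : E →ₗ[𝕜] E).IsSymmetric)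
    (h0 : ∀ v, 0 ≤ RCLike.re (inner 𝕜 v (Q v))) (hu : IsUnit Q) :
    ∃ κ : ℝ, 0 < κ ∧ ∀ v, κ * ‖v‖ ^ 2 ≤ RCLike.re (inner 𝕜 v (Q v)) := by
  obtain ⟨P, hP⟩ := hu.exists_left_inv
  set p := ‖P‖ + 1
  set m := ‖Q‖ + 1
  have hp : 0 < p := by positivity
  have hm : 0 < m := by positivity
  -- The constant combines `‖v‖ ≤ p ‖Q v‖` with `‖Q v‖² ≤ m ⟪v, Q v⟫`; the second follows from
  -- Cauchy-Schwarz for the form of `Q`, applied to `v` and `Q v`.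
  refine ⟨(p ^ 2 * m)⁻¹, by positivity, fun v => ?_⟩
  have hv : ‖v‖ ≤ p * ‖Q v‖ := by
    have h1 : P (Q v) = v := by
      simpa using congrArg (fun f : E →L[𝕜] E => f v) hP
    calc ‖v‖ = ‖P (Q v)‖ := by rw [h1]
      _ ≤ ‖P‖ * ‖Q v‖ := P.le_opNorm _
      _ ≤ p * ‖Q v‖ := by gcongr; simp [p]
  have hcs := sq_re_inner_le_of_nonneg hQ h0 v (Q v)
  rw [inner_self_eq_norm_sq] at hcs
  have hQQ : RCLike.re (inner 𝕜 (Q v) (Q (Q v))) ≤ m * ‖Q v‖ ^ 2 := by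
    calc RCLike.re (inner 𝕜 (Q v) (Q (Q v))) ≤ ‖Q v‖ * ‖Q (Q v)‖ := re_inner_le_norm _ _
      _ ≤ ‖Q v‖ * (m * ‖Q v‖) := by
        gcongr
        exact (Q.le_opNorm _).trans (by gcongr; simp [m])
      _ = _ := by ring
  have h4 : ‖Q v‖ ^ 2 ≤ m * RCLike.re (inner 𝕜 v (Q v)) := by
    rcases eq_or_ne (‖Q v‖) 0 with h | h
    · rw [h]; have := h0 v; simp; positivity
    · have : 0 < ‖Q v‖ ^ 2 := by positivity
      refine le_of_mul_le_mul_left ?_ this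
      nlinarith [mul_le_mul_of_nonneg_right hQQ (h0 v)]
  rw [inv_mul_le_iff₀ (by positivity)]
  calc ‖v‖ ^ 2 ≤ (p * ‖Q v‖) ^ 2 := by gcongr
    _ = p ^ 2 * ‖Q v‖ ^ 2 := by ring
    _ ≤ p ^ 2 * (m * RCLike.re (inner 𝕜 v (Q v))) := by gcongr
    _ = _ := by ring

/-- A symmetric operator whose spectrum avoids `(-c, c)` is bounded below by `c`. -/
theorem le_norm_apply_of_isUnit_sub {D : E →L[𝕜] E} (hD : (D : E →ₗ[𝕜] E).IsSymmetric)
    {c : ℝ} (hc : 0 ≤ c) (hu : ∀ a : ℝ, |a| < c → IsUnit (D - (a : 𝕜) • 1)) (v : E) :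
    c ^ 2 * ‖v‖ ^ 2 ≤ ‖D v‖ ^ 2 := by
  -- Maximality argument: if the largest `s` in `S` were below `c²`, then `D² - s = (D - √s)(D +
  -- √s)` would be positive and invertible, hence coercive, and `s` could be increased.
  set S : Set ℝ := {s | s ≤ c ^ 2 ∧ ∀ v, s * ‖v‖ ^ 2 ≤ ‖D v‖ ^ 2} with hS
  have h0S : (0 : ℝ) ∈ S := ⟨by positivity, fun v => by simp⟩
  have hbdd : BddAbove S := ⟨c ^ 2, fun s hs => hs.1⟩
  have hclosed : IsClosed S := by
    have : S = Set.Iic (c ^ 2) ∩ ⋂ v, {s | s * ‖v‖ ^ 2 ≤ ‖D v‖ ^ 2} := by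
      ext s; simp [hS]
    rw [this]
    exact isClosed_Iic.inter (isClosed_iInter fun v =>
      isClosed_le (by fun_prop) continuous_const)
  have hmem := hclosed.csSup_mem ⟨0, h0S⟩ hbdd
  set s := sSup S
  have hs0 : 0 ≤ s := le_csSup hbdd h0S
  rcases hmem.1.eq_or_lt with h | h
  · rw [← h]; exact hmem.2 v
  exfalso
  set a := √s with ha
  have haa : a * a = s := Real.mul_self_sqrt hs0
  have hac : |a| < c := by
    rw [abs_of_nonneg (Real.sqrt_nonneg _), Real.sqrt_lt' (lt_of_le_of_ne hc ?_)]
    · exact h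
    · rintro rfl; simp at h; linarith
  have hu1 := hu a hac
  have hu2 := hu (-a) (by simpa using hac)
  have hsym : ∀ x y, inner 𝕜 (D x) y = inner 𝕜 x (D y) := hD
  set Q := (D - (a : 𝕜) • 1) * (D - ((-a : ℝ) : 𝕜) • 1) with hQdef
  have hQv : ∀ v, Q v = D (D v) - (s : 𝕜) • v := by
    intro v
    simp only [hQdef, mul_apply_eq_comp, sub_apply,
      smul_apply, one_apply_eq_self, map_sub, map_smul,
      ← haa]
    push_cast
    module
  have hQs : (Q : E →ₗ[𝕜] E).IsSymmetric := by
    intro x y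
    simp only [ContinuousLinearMap.coe_coe, hQv, inner_sub_left, inner_sub_right, hsym,
      inner_smul_left, inner_smul_right, RCLike.conj_ofReal]
  have hQre : ∀ v, RCLike.re (inner 𝕜 v (Q v)) = ‖D v‖ ^ 2 - s * ‖v‖ ^ 2 := by
    intro v
    rw [hQv, inner_sub_right, ← hsym, inner_smul_right, map_sub, RCLike.re_ofReal_mul,
      inner_self_eq_norm_sq, inner_self_eq_norm_sq]
  obtain ⟨κ, hκ, hκv⟩ := exists_coercive_of_isUnit hQs
    (fun v => by rw [hQre]; linarith [hmem.2 v]) (hu1.mul hu2)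
  have : min (s + κ) (c ^ 2) ∈ S := by
    refine ⟨min_le_right _ _, fun v => ?_⟩
    have h1 := hκv v
    rw [hQre] at h1
    calc min (s + κ) (c ^ 2) * ‖v‖ ^ 2 ≤ (s + κ) * ‖v‖ ^ 2 := by gcongr; exact min_le_left _ _
      _ ≤ _ := by linarith
  have h2 := le_csSup hbdd this
  have h3 : s < min (s + κ) (c ^ 2) := lt_min (by linarith) h
  linarith

/-- If `C ≥ 0` and `C² ≥ δ C`, then `C ≥ δ` on the closure of the range of `C`. -/
theorem le_re_inner_of_mem_closure_range {C : E →L[𝕜] E}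
    (hC : (C : E →ₗ[𝕜] E).IsSymmetric) (h0 : ∀ v, 0 ≤ RCLike.re (inner 𝕜 v (C v))) {δ : ℝ}
    (hδ : ∀ v, δ * RCLike.re (inner 𝕜 v (C v)) ≤ ‖C v‖ ^ 2) {y : E}
    (hy : y ∈ closure (Set.range C)) :
    δ * ‖y‖ ^ 2 ≤ RCLike.re (inner 𝕜 y (C y)) := by
  have hcl : IsClosed {y : E | δ * ‖y‖ ^ 2 ≤ RCLike.re (inner 𝕜 y (C y))} :=
    isClosed_le (by fun_prop) (RCLike.continuous_re.comp (by fun_prop))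
  refine closure_minimal ?_ hcl hy
  rintro _ ⟨v, rfl⟩
  change δ * ‖C v‖ ^ 2 ≤ RCLike.re (inner 𝕜 (C v) (C (C v)))
  rcases le_or_gt δ 0 with hn | hpos
  · exact (mul_nonpos_of_nonpos_of_nonneg hn (by positivity)).trans (h0 _)
  -- This gives `‖C v‖⁴ ≤ ⟪C v, C (C v)⟫ ⟪v, C v⟫`; multiplying by `δ` and using `hδ` allows a
  -- factor `‖C v‖²` to be cancelled.
  have hcs := sq_re_inner_le_of_nonneg hC h0 v (C v)
  rw [inner_self_eq_norm_sq] at hcs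
  rcases eq_or_ne (‖C v‖) 0 with h | h
  · rw [h]; simpa using h0 _
  · have hp : 0 < ‖C v‖ ^ 2 := by positivity
    refine le_of_mul_le_mul_left ?_ hp
    nlinarith [mul_le_mul_of_nonneg_left (hδ v) (h0 (C v))]

/-- On a subspace invariant under a symmetric operator, a bound on the quadratic form bounds the
operator. -/
theorem norm_apply_le_of_abs_re_inner_le {B : E →L[𝕜] E} (hB : (B : E →ₗ[𝕜] E).IsSymmetric)
    {W : Submodule 𝕜 E} (hW : ∀ v ∈ W, B v ∈ W) {q : ℝ} (hq : 0 < q)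
    (h : ∀ v ∈ W, |RCLike.re (inner 𝕜 v (B v))| ≤ q * ‖v‖ ^ 2) {v : E} (hv : v ∈ W) :
    ‖B v‖ ≤ q * ‖v‖ := by
  -- Polarization: `4 Re ⟪w, B v⟫` is the difference of the forms at `v + w` and `v - w`, which the
  -- parallelogram law bounds by `2 q (‖v‖² + ‖w‖²)`. With this `w` the left side is `4 ‖B v‖² / q`,
  -- and half of it absorbs the term in `‖w‖²`.
  set w : E := ((q⁻¹ : ℝ) : 𝕜) • B v with hw
  have hwW : w ∈ W := W.smul_mem _ (hW v hv)
  have h1 := (abs_le.1 (h _ (W.add_mem hv hwW))).2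
  have h2 := (abs_le.1 (h _ (W.sub_mem hv hwW))).1
  have hpar := parallelogram_law_with_norm 𝕜 v w
  have hsymm := re_inner_symm_apply hB w v
  have hwB : RCLike.re (inner 𝕜 w (B v)) = q⁻¹ * ‖B v‖ ^ 2 := by
    rw [hw, inner_smul_left, RCLike.conj_ofReal, RCLike.re_ofReal_mul, inner_self_eq_norm_sq]
  have hnw : ‖w‖ = q⁻¹ * ‖B v‖ := by
    rw [hw, norm_smul, RCLike.norm_ofReal, abs_of_pos (by positivity)]
  simp only [map_add, map_sub, inner_add_left, inner_add_right, inner_sub_left,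
    inner_sub_right] at h1 h2
  have key : 4 * (q⁻¹ * ‖B v‖ ^ 2) ≤ q * (2 * (‖v‖ ^ 2 + ‖w‖ ^ 2)) := by
    rw [hsymm, hwB] at h1 h2
    nlinarith
  rw [hnw] at key
  have h3 : ‖B v‖ ^ 2 ≤ (q * ‖v‖) ^ 2 := by
    have e : q * (2 * (‖v‖ ^ 2 + (q⁻¹ * ‖B v‖) ^ 2)) =
        2 * q * ‖v‖ ^ 2 + 2 * (q⁻¹ * ‖B v‖ ^ 2) := by
      field_simp
    rw [e] at key
    have h5 : q⁻¹ * ‖B v‖ ^ 2 ≤ q * ‖v‖ ^ 2 := by linarith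
    rw [inv_mul_le_iff₀ hq] at h5
    nlinarith
  exact (pow_le_pow_iff_left₀ (norm_nonneg _) (by positivity) two_ne_zero).1 h3

end SelfAdjoint

/-! ### The Richardson operator and the spectral gap -/

section SpectralGap

variable {𝕜 E : Type*} [RCLike 𝕜] [NormedAddCommGroup E] [InnerProductSpace 𝕜 E]

/-- The operator `1 - α (A - μ)` of the Richardson iteration. -/
noncomputable def richardson (A : E →L[𝕜] E) (μ α : ℝ) : E →L[𝕜] E :=
  ((1 + α * μ : ℝ) : 𝕜) • 1 - (α : 𝕜) • A

theorem richardson_apply (A : E →L[𝕜] E) (μ α : ℝ) (v : E) :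
    richardson A μ α v = ((1 + α * μ : ℝ) : 𝕜) • v - (α : 𝕜) • A v := by
  simp [richardson]

theorem richardson_apply_of_eigenvector {A : E →L[𝕜] E} {μ : ℝ} (α : ℝ) {u : E}
    (hu : A u = (μ : 𝕜) • u) : richardson A μ α u = u := by
  rw [richardson_apply, hu]
  push_cast
  module

theorem richardson_isSymmetric {A : E →L[𝕜] E} (hA : (A : E →ₗ[𝕜] E).IsSymmetric) (μ α : ℝ) :
    (richardson A μ α : E →ₗ[𝕜] E).IsSymmetric := by
  intro x y
  have h : inner 𝕜 (A x) y = inner 𝕜 x (A y) := hA x y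
  simp only [ContinuousLinearMap.coe_coe, richardson_apply, inner_sub_left, inner_sub_right,
    inner_smul_left, inner_smul_right, RCLike.conj_ofReal, h]

theorem inner_richardson_eq_zero {A : E →L[𝕜] E} (hA : (A : E →ₗ[𝕜] E).IsSymmetric) {μ α : ℝ}
    {u v : E} (hu : A u = (μ : 𝕜) • u) (hv : inner 𝕜 u v = 0) :
    inner 𝕜 u (richardson A μ α v) = 0 := by
  have h : inner 𝕜 (richardson A μ α u) v = inner 𝕜 u (richardson A μ α v) :=
    richardson_isSymmetric hA μ α u v
  rw [← h, richardson_apply_of_eigenvector α hu, hv]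

/-- The spectral gap above a simple smallest eigenvalue, as a bound for the quadratic form on the
orthogonal complement of the eigenvector. -/
theorem le_re_inner_of_inner_eigenvector_eq_zero [CompleteSpace E] {A : E →L[𝕜] E}
    (hA : IsSelfAdjoint A) {μ ν : ℝ} (hμν : μ < ν)
    (hlow : ∀ v, μ * ‖v‖ ^ 2 ≤ RCLike.re (inner 𝕜 v (A v)))
    (hsimple : Module.finrank 𝕜
      (Module.End.eigenspace (A : E →ₗ[𝕜] E) (μ : 𝕜)) = 1)
    (hspec : ∀ a : ℝ, μ < a → a < ν → (a : 𝕜) ∉ spectrum 𝕜 A)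
    {u : E} (hu : u ≠ 0) (hAu : A u = (μ : 𝕜) • u) {v : E} (hv : inner 𝕜 u v = 0) :
    ν * ‖v‖ ^ 2 ≤ RCLike.re (inner 𝕜 v (A v)) := by
  have hAs : (A : E →ₗ[𝕜] E).IsSymmetric := hA.isSymmetric
  have hAs' : ∀ x y, inner 𝕜 (A x) y = inner 𝕜 x (A y) := hAs
  have hsub : ∀ (a : ℝ) (w : E), (A - (a : 𝕜) • (1 : E →L[𝕜] E)) w = A w - (a : 𝕜) • w := by
    intro a w; simp
  have hsa : ∀ a : ℝ, IsSelfAdjoint (A - (a : 𝕜) • (1 : E →L[𝕜] E)) := fun a => by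
    refine hA.sub (IsSelfAdjoint.smul ?_ (IsSelfAdjoint.one _))
    exact RCLike.conj_ofReal a
  have hre : ∀ (a : ℝ) (w : E), RCLike.re (inner 𝕜 w ((A - (a : 𝕜) • (1 : E →L[𝕜] E)) w)) =
      RCLike.re (inner 𝕜 w (A w)) - a * ‖w‖ ^ 2 := by
    intro a w
    rw [hsub, inner_sub_right, inner_smul_right, map_sub, RCLike.re_ofReal_mul,
      inner_self_eq_norm_sq]
  set C := A - (μ : 𝕜) • (1 : E →L[𝕜] E) with hC
  set δ := ν - μ with hδ
  have hCnn : ∀ w, 0 ≤ RCLike.re (inner 𝕜 w (C w)) := fun w => by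
    rw [hC, hre]; linarith [hlow w]
  -- Shifting `A` by the midpoint of `(μ, ν)` makes the gap symmetric about zero, so `‖C w - (δ/2)
  -- w‖ ≥ (δ/2) ‖w‖`; expanding the square leaves the claim.
  have hquad : ∀ w, δ * RCLike.re (inner 𝕜 w (C w)) ≤ ‖C w‖ ^ 2 := by
    intro w
    have h := le_norm_apply_of_isUnit_sub (hsa ((μ + ν) / 2)).isSymmetric (c := δ / 2)
      (by linarith) (fun a ha => by
        have ha' := abs_lt.1 ha
        have h := hspec (a + (μ + ν) / 2) (by linarith) (by linarith)
        rw [spectrum.notMem_iff, ← IsUnit.neg_iff] at h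
        convert h using 1
        rw [Algebra.algebraMap_eq_smul_one]
        push_cast
        module) w
    have h1 : (A - (((μ + ν) / 2 : ℝ) : 𝕜) • (1 : E →L[𝕜] E)) w =
        C w - ((δ / 2 : ℝ) : 𝕜) • w := by
      rw [hsub, hC, hsub, hδ]
      push_cast
      module
    rw [h1, @norm_sub_sq 𝕜, norm_smul, inner_smul_right, RCLike.re_ofReal_mul, mul_pow,
      RCLike.norm_ofReal, sq_abs, inner_re_symm] at h
    linarith
  -- By simplicity the kernel of `C` is spanned by `u`; its orthogonal complement is the closure of
  -- the range because `C` is self-adjoint.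
  have hker : v ∈ C.kerᗮ := by
    rw [Submodule.mem_orthogonal]
    intro w hw
    have hw' : w ∈ Module.End.eigenspace (A : E →ₗ[𝕜] E) (μ : 𝕜) := by
      rw [Module.End.mem_eigenspace_iff]
      have h1 : C w = 0 := hw
      rw [hC, hsub, sub_eq_zero] at h1
      exact h1
    have hu' : u ∈ Module.End.eigenspace (A : E →ₗ[𝕜] E) (μ : 𝕜) :=
      Module.End.mem_eigenspace_iff.2 hAu
    obtain ⟨c, hc⟩ := (finrank_eq_one_iff_of_nonzero'
      (⟨u, hu'⟩ : Module.End.eigenspace (A : E →ₗ[𝕜] E) (μ : 𝕜))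
      (by simpa using hu)).1 hsimple ⟨w, hw'⟩
    have hcw : c • u = w := congrArg Subtype.val hc
    rw [← hcw, inner_smul_left, hv, mul_zero]
  have hcl : v ∈ closure (Set.range C) := by
    rw [ContinuousLinearMap.orthogonal_ker, ← ContinuousLinearMap.star_eq_adjoint,
      (hsa μ).star_eq] at hker
    exact hker
  have h := le_re_inner_of_mem_closure_range (hsa μ).isSymmetric hCnn hquad hcl
  change δ * ‖v‖ ^ 2 ≤ RCLike.re (inner 𝕜 v (C v)) at h
  rw [hC, hre] at h
  linarith

/-- The step size equioscillates: `1 - α (x - μ)` equals `(Γ - ν) / (ν + Γ - 2 μ)` at `x = ν` and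
its negative at `x = Γ`. -/
theorem norm_richardson_apply_le [CompleteSpace E] {A : E →L[𝕜] E}
    (hA : IsSelfAdjoint A) {μ ν Γ : ℝ} (hμν : μ < ν) (hνΓ : ν < Γ)
    (hlow : ∀ v, μ * ‖v‖ ^ 2 ≤ RCLike.re (inner 𝕜 v (A v)))
    (hup : ∀ v, RCLike.re (inner 𝕜 v (A v)) ≤ Γ * ‖v‖ ^ 2)
    (hsimple : Module.finrank 𝕜
      (Module.End.eigenspace (A : E →ₗ[𝕜] E) (μ : 𝕜)) = 1)
    (hspec : ∀ a : ℝ, μ < a → a < ν → (a : 𝕜) ∉ spectrum 𝕜 A)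
    {u : E} (hu : u ≠ 0) (hAu : A u = (μ : 𝕜) • u) {v : E} (hv : inner 𝕜 u v = 0) :
    ‖richardson A μ (2 / (ν + Γ - 2 * μ)) v‖ ≤ (Γ - ν) / (ν + Γ - 2 * μ) * ‖v‖ := by
  have hs : 0 < ν + Γ - 2 * μ := by linarith
  set α := 2 / (ν + Γ - 2 * μ) with hα
  have hmem : ∀ w, w ∈ (𝕜 ∙ u)ᗮ ↔ inner 𝕜 u w = 0 := fun w =>
    Submodule.mem_orthogonal_singleton_iff_inner_right
  refine norm_apply_le_of_abs_re_inner_le (W := (𝕜 ∙ u)ᗮ)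
    (richardson_isSymmetric hA.isSymmetric μ α) (fun w hw => ?_)
    (div_pos (by linarith) hs) (fun w hw => ?_) ((hmem v).2 hv)
  · exact (hmem _).2 (inner_richardson_eq_zero hA.isSymmetric hAu ((hmem w).1 hw))
  · have h1 := le_re_inner_of_inner_eigenvector_eq_zero hA hμν hlow hsimple hspec hu hAu
      ((hmem w).1 hw)
    have h2 := hup w
    rw [richardson_apply, inner_sub_right, inner_smul_right, inner_smul_right, map_sub,
      RCLike.re_ofReal_mul, RCLike.re_ofReal_mul, inner_self_eq_norm_sq]
    have e : (1 + α * μ) * ‖w‖ ^ 2 - α * RCLike.re (inner 𝕜 w (A w)) =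
        ((ν + Γ) * ‖w‖ ^ 2 - 2 * RCLike.re (inner 𝕜 w (A w))) / (ν + Γ - 2 * μ) := by
      rw [hα]; field_simp; ring
    rw [e, abs_div, abs_of_pos hs, div_mul_eq_mul_div]
    gcongr
    rw [abs_le]
    constructor <;> linarith

end SpectralGap

/-! ### Sums of elementary tensors: growth under operators, rank and overlap -/

namespace HilbertTensor

variable {𝕜 : Type*} [RCLike 𝕜] {ι : Type*} [Fintype ι] [DecidableEq ι] {H : ι → Type*}
  [∀ i, NormedAddCommGroup (H i)] [∀ i, InnerProductSpace 𝕜 (H i)]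

/-- `w` is a sum of `n` tensors of the form `a ⊗ b`. -/
def IsMergeSum (t : Finset ι) (n : ℕ) (w : HilbertTensor 𝕜 H) : Prop :=
  ∃ (a : Fin n → InPart 𝕜 H t) (b : Fin n → OutPart 𝕜 H t), w = ∑ j, merge t (a j) (b j)

theorem isMergeSum_merge (t : Finset ι) (a : InPart 𝕜 H t) (b : OutPart 𝕜 H t) :
    IsMergeSum t 1 (merge t a b) :=
  ⟨fun _ => a, fun _ => b, by simp⟩

theorem IsMergeSum.smul {t : Finset ι} {n : ℕ} {w : HilbertTensor 𝕜 H} (c : 𝕜)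
    (h : IsMergeSum t n w) : IsMergeSum t n (c • w) := by
  obtain ⟨a, b, rfl⟩ := h
  exact ⟨fun j => c • a j, b, by simp [Finset.smul_sum]⟩

theorem IsMergeSum.apply {t : Finset ι} {n m : ℕ} {w : HilbertTensor 𝕜 H}
    {B : HilbertTensor 𝕜 H →L[𝕜] HilbertTensor 𝕜 H}
    {S : Fin m → (InPart 𝕜 H t →L[𝕜] InPart 𝕜 H t)}
    {T : Fin m → (OutPart 𝕜 H t →L[𝕜] OutPart 𝕜 H t)} (hB : IsTensorSum t B S T)
    (h : IsMergeSum t n w) : IsMergeSum t (n * m) (B w) := by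
  obtain ⟨a, b, rfl⟩ := h
  refine ⟨fun j => S (finProdFinEquiv.symm j).2 (a (finProdFinEquiv.symm j).1),
    fun j => T (finProdFinEquiv.symm j).2 (b (finProdFinEquiv.symm j).1), ?_⟩
  rw [Equiv.sum_comp finProdFinEquiv.symm
    (fun p : Fin n × Fin m => merge t (S p.2 (a p.1)) (T p.2 (b p.1))), Fintype.sum_prod_type,
    map_sum]
  exact Finset.sum_congr rfl fun j _ => hB _ _

theorem IsMergeSum.iterate {t : Finset ι} {n m : ℕ} {w : HilbertTensor 𝕜 H}
    {B : HilbertTensor 𝕜 H →L[𝕜] HilbertTensor 𝕜 H}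
    {S : Fin m → (InPart 𝕜 H t →L[𝕜] InPart 𝕜 H t)}
    {T : Fin m → (OutPart 𝕜 H t →L[𝕜] OutPart 𝕜 H t)} (hB : IsTensorSum t B S T)
    (h : IsMergeSum t n w) (k : ℕ) : IsMergeSum t (n * m ^ k) (B^[k] w) := by
  induction k with
  | zero => simpa using h
  | succ k ih =>
    rw [Function.iterate_succ_apply', pow_succ, ← mul_assoc]
    exact ih.apply hB

/-- A combination of the identity and of a sum of `n` elementary operators is a sum of `n + 1`
elementary operators, and of `n` if one of the factors is the identity. -/
theorem IsTensorSum.exists_smul_one_sub_smul {t : Finset ι}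
    {A : HilbertTensor 𝕜 H →L[𝕜] HilbertTensor 𝕜 H} {n : ℕ}
    {S : Fin n → (InPart 𝕜 H t →L[𝕜] InPart 𝕜 H t)}
    {T : Fin n → (OutPart 𝕜 H t →L[𝕜] OutPart 𝕜 H t)} (hA : IsTensorSum t A S T) {R : ℕ}
    (hR : R = n + 1 ∨ (R = n ∧ ∃ i, S i = 1 ∨ T i = 1)) (β α : 𝕜) :
    ∃ (S' : Fin R → (InPart 𝕜 H t →L[𝕜] InPart 𝕜 H t))
      (T' : Fin R → (OutPart 𝕜 H t →L[𝕜] OutPart 𝕜 H t)),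
      IsTensorSum t (β • 1 - α • A) S' T' := by
  have hBv : ∀ a b, (β • 1 - α • A : HilbertTensor 𝕜 H →L[𝕜] HilbertTensor 𝕜 H) (merge t a b) =
      β • merge t a b - α • ∑ i, merge t (S i a) (T i b) := by
    intro a b
    rw [← hA a b]
    simp
  rcases hR with rfl | ⟨rfl, i, hi | hi⟩
  · refine ⟨Fin.cons (β • 1) fun i => -α • S i, Fin.cons 1 T, fun a b => ?_⟩
    rw [hBv, Fin.sum_univ_succ]
    simp [Finset.smul_sum, sub_eq_add_neg]
  -- The identity `1 ⊗ 1` shares its left factor with term `i`, so it is absorbed into the right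
  -- factor there and costs no extra term.
  · refine ⟨S, Function.update (fun j => -α • T j) i (β • 1 - α • T i), fun a b => ?_⟩
    have h : ∑ j ∈ Finset.univ.erase i, merge t (S j a)
        (Function.update (fun j => -α • T j) i (β • 1 - α • T i) j b) =
        ∑ j ∈ Finset.univ.erase i, merge t (S j a) ((-α • T j) b) :=
      Finset.sum_congr rfl fun j hj => by rw [Function.update_of_ne (Finset.ne_of_mem_erase hj)]
    rw [hBv, ← Finset.add_sum_erase _ _ (Finset.mem_univ i),
      ← Finset.add_sum_erase _ (fun j => merge t (S j a) _) (Finset.mem_univ i), h]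
    simp only [Function.update_self, hi, neg_smul, neg_apply, map_neg, Finset.sum_neg_distrib,
      smul_apply, sub_apply, one_apply_eq_self, map_smul, map_sub, ← Finset.smul_sum]
    module
  · refine ⟨Function.update (fun j => -α • S j) i (β • 1 - α • S i), T, fun a b => ?_⟩
    have h : ∑ j ∈ Finset.univ.erase i, merge t
        (Function.update (fun j => -α • S j) i (β • 1 - α • S i) j a) (T j b) =
        ∑ j ∈ Finset.univ.erase i, merge t ((-α • S j) a) (T j b) :=
      Finset.sum_congr rfl fun j hj => by rw [Function.update_of_ne (Finset.ne_of_mem_erase hj)]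
    rw [hBv, ← Finset.add_sum_erase _ _ (Finset.mem_univ i),
      ← Finset.add_sum_erase _ (fun j => merge t _ (T j b)) (Finset.mem_univ i), h]
    simp only [Function.update_self, hi, neg_smul, neg_apply, map_neg, Finset.sum_neg_distrib,
      smul_apply, sub_apply, one_apply_eq_self, map_smul, map_sub, ← Finset.smul_sum]
    module

theorem norm_merge (t : Finset ι) (a : InPart 𝕜 H t) (b : OutPart 𝕜 H t) :
    ‖merge t a b‖ = ‖a‖ * ‖b‖ := by
  have h := inner_merge t a a b b
  simp only [inner_self_eq_norm_sq_to_K] at h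
  have h' : ‖merge t a b‖ ^ 2 = (‖a‖ * ‖b‖) ^ 2 := by
    rw [mul_pow]
    exact_mod_cast h
  exact (pow_left_inj₀ (norm_nonneg _) (by positivity) two_ne_zero).1 h'

theorem IsMergeSum.tRank_le {t : Finset ι} {n : ℕ} {w : HilbertTensor 𝕜 H}
    (h : IsMergeSum t n w) : tRank t w ≤ n := by
  obtain ⟨a, b, rfl⟩ := h
  have hle : LinearMap.range (matricize t (∑ j, merge t (a j) (b j))) ≤
      Submodule.span 𝕜 (Set.range b) := by
    rintro _ ⟨x, rfl⟩
    have : matricize t (∑ j, merge t (a j) (b j)) x = ∑ j, inner 𝕜 x (a j) • b j := by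
      change ContinuousLinearMap.adjoint (merge t x) (∑ j, merge t (a j) (b j)) = _
      rw [map_sum]
      exact Finset.sum_congr rfl fun j _ => matricize_merge t (a j) x (b j)
    rw [this]
    exact Submodule.sum_mem _ fun j _ =>
      Submodule.smul_mem _ _ (Submodule.subset_span ⟨j, rfl⟩)
  have h1 : Module.rank 𝕜 (LinearMap.range (matricize t (∑ j, merge t (a j) (b j)))) ≤ (n : ℕ) := by
    refine (Submodule.rank_mono hle).trans ((rank_span_le _).trans ?_)
    simpa using Cardinal.mk_range_le_lift (f := b)
  have h2 := OrderHomClass.mono Cardinal.toENat h1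
  simpa [tRank] using h2

theorem tRank_merge {t : Finset ι} {a : InPart 𝕜 H t} {b : OutPart 𝕜 H t} (ha : a ≠ 0)
    (hb : b ≠ 0) : tRank t (merge t a b) = 1 := by
  refine le_antisymm (by simpa using (isMergeSum_merge t a b).tRank_le) ?_
  rw [tRank, Cardinal.one_le_toENat, Cardinal.one_le_iff_ne_zero, Ne,
    rank_zero_iff_forall_zero]
  intro h
  have h1 := h ⟨_, a, rfl⟩
  rw [Subtype.ext_iff] at h1
  change matricize t (merge t a b) a = 0 at h1
  rw [matricize_merge] at h1
  exact (smul_ne_zero (inner_self_ne_zero.2 ha) hb) h1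

/-- Every full elementary tensor splits along `t` as some `a ⊗ b`, and these span a dense subspace.
This is what makes the supremum of overlaps positive. -/
theorem eq_zero_of_inner_merge_eq_zero (t : Finset ι) {w : HilbertTensor 𝕜 H}
    (h : ∀ a b, inner 𝕜 w (merge t a b) = 0) : w = 0 := by
  have h1 : ∀ z : HilbertTensor 𝕜 H, inner 𝕜 w z = 0 := by
    intro z
    induction z using UniformSpace.Completion.induction_on with
    | hp => exact isClosed_eq (by fun_prop) continuous_const
    | ih z =>
      induction z using AlgTensor.induction_on with
      | ha x y hx hy => rw [UniformSpace.Completion.coe_add, inner_add_right, hx, hy, add_zero]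
      | hs r f =>
        have h2 := h (AlgTensor.tprod 𝕜 fun i : {i // i ∈ t} => f i :)
          (AlgTensor.tprod 𝕜 fun i : {i // i ∉ t} => f i :)
        rw [merge_coe, AlgTensor.mergeAlg_tprod] at h2
        simp only [dite_eq_ite, ite_self] at h2
        rw [UniformSpace.Completion.coe_smul, inner_smul_right, h2, mul_zero]
  exact inner_self_eq_zero.1 (h1 w)

/-- If `u` has overlap at most `θ` with normalized elementary tensors, then it has overlap at most
`√n θ` with normalized sums of `n` elementary tensors. -/
theorem IsMergeSum.norm_inner_sq_le {t : Finset ι} {u : HilbertTensor 𝕜 H} {θ : ℝ}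
    (hθ : ∀ a b, ‖inner 𝕜 u (merge t a b)‖ ≤ θ * (‖a‖ * ‖b‖)) {n : ℕ}
    {w : HilbertTensor 𝕜 H} (hw : IsMergeSum t n w) :
    ‖inner 𝕜 u w‖ ^ 2 ≤ n * θ ^ 2 * ‖w‖ ^ 2 := by
  obtain ⟨a, b, rfl⟩ := hw
  -- Rewriting the sum over an orthonormal basis of the span of the left factors makes its at most
  -- `n` terms mutually orthogonal. This replaces the singular value decomposition.
  set V := Submodule.span 𝕜 (Set.range a)
  have : FiniteDimensional 𝕜 V := FiniteDimensional.span_of_finite 𝕜 (Set.finite_range a)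
  set e := stdOrthonormalBasis 𝕜 V
  have hm : Module.finrank 𝕜 V ≤ n :=
    (finrank_range_le_card (R := 𝕜) a).trans_eq (Fintype.card_fin n)
  have haV : ∀ j, a j ∈ V := fun j => Submodule.subset_span ⟨j, rfl⟩
  set c : Fin (Module.finrank 𝕜 V) → OutPart 𝕜 H t :=
    fun k => ∑ j, inner 𝕜 (e k) (⟨a j, haV j⟩ : V) • b j with hc
  have hwe : ∑ j, merge t (a j) (b j) = ∑ k, merge t (e k : InPart 𝕜 H t) (c k) := by
    have h1 : ∀ j, a j = ∑ k, inner 𝕜 (e k) (⟨a j, haV j⟩ : V) • (e k : InPart 𝕜 H t) := by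
      intro j
      have := congrArg Subtype.val (e.sum_repr' ⟨a j, haV j⟩)
      simpa using this.symm
    calc ∑ j, merge t (a j) (b j)
        = ∑ j, merge t (∑ k, inner 𝕜 (e k) (⟨a j, haV j⟩ : V) • (e k : InPart 𝕜 H t)) (b j) :=
          Finset.sum_congr rfl fun j _ => by rw [← h1 j]
      _ = ∑ j, ∑ k, merge t (e k : InPart 𝕜 H t)
            (inner 𝕜 (e k) (⟨a j, haV j⟩ : V) • b j) := by
          refine Finset.sum_congr rfl fun j _ => ?_
          rw [map_sum, sum_apply]
          simp
      _ = _ := by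
          rw [Finset.sum_comm]
          simp only [hc, map_sum]
  have he : ∀ k l, inner 𝕜 (e k : InPart 𝕜 H t) (e l : InPart 𝕜 H t) = if k = l then 1 else 0 :=
    fun k l => (orthonormal_iff_ite.1 e.orthonormal k l)
  have hen : ∀ k, ‖(e k : InPart 𝕜 H t)‖ = 1 := fun k => e.orthonormal.1 k
  have hnorm : ‖∑ k, merge t (e k : InPart 𝕜 H t) (c k)‖ ^ 2 = ∑ k, ‖c k‖ ^ 2 := by
    have h2 : inner 𝕜 (∑ k, merge t (e k : InPart 𝕜 H t) (c k))
        (∑ k, merge t (e k : InPart 𝕜 H t) (c k)) = ∑ k, (‖c k‖ : 𝕜) ^ 2 := by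
      rw [sum_inner]
      simp only [inner_sum, inner_merge, he, ite_mul, one_mul, zero_mul, Finset.sum_ite_eq,
        Finset.mem_univ, if_true, inner_self_eq_norm_sq_to_K]
    rw [inner_self_eq_norm_sq_to_K] at h2
    exact_mod_cast h2
  rw [hwe, hnorm, inner_sum]
  -- The factor `n` arises from Cauchy-Schwarz on the sum of the norms `‖c k‖`; `|θ|` appears
  -- because no sign of `θ` is assumed.
  calc ‖∑ k, inner 𝕜 u (merge t (e k : InPart 𝕜 H t) (c k))‖ ^ 2
      ≤ (∑ k, |θ| * ‖c k‖) ^ 2 := by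
        gcongr
        refine norm_sum_le_of_le _ fun k _ => (hθ _ _).trans ?_
        rw [hen, one_mul]
        gcongr
        exact le_abs_self θ
    _ = θ ^ 2 * (∑ k, ‖c k‖) ^ 2 := by rw [← Finset.mul_sum, mul_pow, sq_abs]
    _ ≤ θ ^ 2 * (Module.finrank 𝕜 V * ∑ k, ‖c k‖ ^ 2) := by
        gcongr
        simpa using sq_sum_le_card_mul_sum_sq (s := Finset.univ) (f := fun k => ‖c k‖)
    _ ≤ θ ^ 2 * (n * ∑ k, ‖c k‖ ^ 2) := by gcongr
    _ = _ := by ring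

end HilbertTensor

/-! ### Power iteration towards the fixed vector -/

section Iterate

variable {𝕜 E : Type*} [RCLike 𝕜] [NormedAddCommGroup E] [InnerProductSpace 𝕜 E]

/-- The power iteration with an operator that fixes `e` and contracts the orthogonal complement of
`e`. -/
theorem iterate_contraction {B : E →L[𝕜] E} {e : E} {q : ℝ} (hq : 0 ≤ q) (he : ‖e‖ = 1)
    (hBe : B e = e) (hB0 : ∀ v, inner 𝕜 e v = 0 → inner 𝕜 e (B v) = 0)
    (hBq : ∀ v, inner 𝕜 e v = 0 → ‖B v‖ ≤ q * ‖v‖) {v : E} (hv : ‖v‖ = 1) (k : ℕ) :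
    inner 𝕜 e (B^[k] v) = inner 𝕜 e v ∧ ‖B^[k] v - (inner 𝕜 e v : 𝕜) • e‖ ≤ q ^ k := by
  have hee : inner 𝕜 e e = (1 : 𝕜) := by simp [inner_self_eq_norm_sq_to_K, he]
  suffices h : inner 𝕜 e (B^[k] v - (inner 𝕜 e v : 𝕜) • e) = 0 ∧
      ‖B^[k] v - (inner 𝕜 e v : 𝕜) • e‖ ≤ q ^ k by
    refine ⟨?_, h.2⟩
    have h1 := h.1
    rwa [inner_sub_right, inner_smul_right, hee, mul_one, sub_eq_zero] at h1
  induction k with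
  | zero =>
    have h0 : inner 𝕜 e (v - (inner 𝕜 e v : 𝕜) • e) = 0 := by
      rw [inner_sub_right, inner_smul_right, hee, mul_one, sub_self]
    refine ⟨h0, ?_⟩
    have h1 := norm_add_sq_eq_norm_sq_add_norm_sq_of_inner_eq_zero
      ((inner 𝕜 e v : 𝕜) • e) (v - (inner 𝕜 e v : 𝕜) • e)
      (𝕜 := 𝕜) (by rw [inner_smul_left, h0, mul_zero])
    rw [add_sub_cancel, hv] at h1
    simp only [Function.iterate_zero, id_eq, pow_zero]
    nlinarith [norm_nonneg (v - (inner 𝕜 e v : 𝕜) • e),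
      mul_self_nonneg ‖(inner 𝕜 e v : 𝕜) • e‖]
  | succ k ih =>
    have h : B^[k + 1] v - (inner 𝕜 e v : 𝕜) • e = B (B^[k] v - (inner 𝕜 e v : 𝕜) • e) := by
      rw [Function.iterate_succ_apply', map_sub, map_smul, hBe]
    rw [h]
    refine ⟨hB0 _ ih.1, (hBq _ ih.1).trans ?_⟩
    rw [pow_succ']
    gcongr
    exact ih.2

theorem norm_sq_le_of_norm_sub_le {e w : E} (he : ‖e‖ = 1) {ρ : ℝ}
    (h : ‖w - (inner 𝕜 e w : 𝕜) • e‖ ≤ ρ) : ‖w‖ ^ 2 ≤ ‖(inner 𝕜 e w : 𝕜)‖ ^ 2 + ρ ^ 2 := by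
  have hee : inner 𝕜 e e = (1 : 𝕜) := by simp [inner_self_eq_norm_sq_to_K, he]
  have h1 := norm_add_sq_eq_norm_sq_add_norm_sq_of_inner_eq_zero
    ((inner 𝕜 e w : 𝕜) • e) (w - (inner 𝕜 e w : 𝕜) • e) (𝕜 := 𝕜) (by
      rw [inner_smul_left, inner_sub_right, inner_smul_right, hee, mul_one, sub_self, mul_zero])
  rw [add_sub_cancel, norm_smul, he, mul_one] at h1
  nlinarith [norm_nonneg (w - (inner 𝕜 e w : 𝕜) • e)]

end Iterate

/-! ### The supremum of elementary overlaps and its relation to `theta` and `tau` -/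

namespace HilbertTensor

variable {𝕜 : Type*} [RCLike 𝕜] {ι : Type*} [Fintype ι] [DecidableEq ι] {H : ι → Type*}
  [∀ i, NormedAddCommGroup (H i)] [∀ i, InnerProductSpace 𝕜 (H i)]

/-- The overlaps of `e` with normalized elementary tensors `a ⊗ b`. -/
def overlaps (t : Finset ι) (e : HilbertTensor 𝕜 H) : Set ℝ :=
  {x | ∃ a b, ‖a‖ = 1 ∧ ‖b‖ = 1 ∧ x = ‖(inner 𝕜 e (merge t a b) : 𝕜)‖}

theorem exists_isLUB_overlaps (t : Finset ι) {e : HilbertTensor 𝕜 H} (he : e ≠ 0) :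
    ∃ θ, 0 < θ ∧ IsLUB (overlaps t e) θ := by
  have h : ∃ a b, inner 𝕜 e (merge t a b) ≠ 0 := by
    by_contra! h
    exact he (eq_zero_of_inner_merge_eq_zero t h)
  obtain ⟨a, b, hab⟩ := h
  have ha : ‖a‖ ≠ 0 := by rintro h; rw [norm_eq_zero] at h; simp [h] at hab
  have hb : ‖b‖ ≠ 0 := by rintro h; rw [norm_eq_zero] at h; simp [h] at hab
  have hmem : ‖(inner 𝕜 e (merge t a b) : 𝕜)‖ / (‖a‖ * ‖b‖) ∈ overlaps t e := by
    refine ⟨((‖a‖⁻¹ : ℝ) : 𝕜) • a, ((‖b‖⁻¹ : ℝ) : 𝕜) • b, ?_, ?_, ?_⟩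
    · rw [norm_smul, RCLike.norm_ofReal, abs_of_nonneg (by positivity), inv_mul_cancel₀ ha]
    · rw [norm_smul, RCLike.norm_ofReal, abs_of_nonneg (by positivity), inv_mul_cancel₀ hb]
    · rw [map_smul, map_smul, smul_apply, inner_smul_right, inner_smul_right, norm_mul, norm_mul,
        RCLike.norm_ofReal, RCLike.norm_ofReal, abs_of_nonneg (by positivity),
        abs_of_nonneg (by positivity)]
      field_simp
  have hbdd : BddAbove (overlaps t e) := by
    refine ⟨‖e‖, ?_⟩
    rintro _ ⟨a, b, ha, hb, rfl⟩
    simpa [norm_merge, ha, hb] using norm_inner_le_norm (𝕜 := 𝕜) e (merge t a b)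
  have hlub := isLUB_csSup ⟨_, hmem⟩ hbdd
  exact ⟨_, lt_of_lt_of_le (by have := norm_pos_iff.2 hab; positivity) (hlub.1 hmem), hlub⟩

theorem norm_inner_merge_le {t : Finset ι} {e : HilbertTensor 𝕜 H} {θ : ℝ}
    (hθ : θ ∈ upperBounds (overlaps t e)) (a : InPart 𝕜 H t) (b : OutPart 𝕜 H t) :
    ‖(inner 𝕜 e (merge t a b) : 𝕜)‖ ≤ θ * (‖a‖ * ‖b‖) := by
  rcases eq_or_ne a 0 with rfl | ha
  · simp
  rcases eq_or_ne b 0 with rfl | hb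
  · simp
  have ha' : 0 < ‖a‖ := norm_pos_iff.2 ha
  have hb' : 0 < ‖b‖ := norm_pos_iff.2 hb
  have h := hθ ⟨((‖a‖⁻¹ : ℝ) : 𝕜) • a, ((‖b‖⁻¹ : ℝ) : 𝕜) • b,
    by rw [norm_smul, RCLike.norm_ofReal, abs_of_nonneg (by positivity), inv_mul_cancel₀ ha'.ne'],
    by rw [norm_smul, RCLike.norm_ofReal, abs_of_nonneg (by positivity), inv_mul_cancel₀ hb'.ne'],
    rfl⟩
  rw [map_smul, map_smul, smul_apply, inner_smul_right, inner_smul_right, norm_mul, norm_mul,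
    RCLike.norm_ofReal, RCLike.norm_ofReal, abs_of_nonneg (by positivity),
    abs_of_nonneg (by positivity)] at h
  calc ‖(inner 𝕜 e (merge t a b) : 𝕜)‖
      = (‖b‖⁻¹ * (‖a‖⁻¹ * ‖(inner 𝕜 e (merge t a b) : 𝕜)‖)) * (‖a‖ * ‖b‖) := by field_simp
    _ ≤ θ * (‖a‖ * ‖b‖) := by gcongr

/-- Normalized tensors `a ⊗ b` have `t`-rank one and so compete in `theta`. The converse is not
needed for a lower bound. -/
theorem le_theta {t : Finset ι} {u : HilbertTensor 𝕜 H} {θ : ℝ}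
    (hθ : IsLUB (overlaps t (((‖u‖⁻¹ : ℝ) : 𝕜) • u)) θ) : θ ≤ theta t u := by
  refine hθ.2 ?_
  rintro _ ⟨a, b, ha, hb, rfl⟩
  have hbdd : BddAbove (Set.range fun v : {v : HilbertTensor 𝕜 H // tRank t v = 1 ∧ ‖v‖ = 1} =>
      ‖(inner 𝕜 (((‖u‖⁻¹ : ℝ) : 𝕜) • u) (v : HilbertTensor 𝕜 H) : 𝕜)‖) := by
    refine ⟨‖((‖u‖⁻¹ : ℝ) : 𝕜) • u‖, ?_⟩
    rintro _ ⟨v, rfl⟩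
    simpa [v.2.2] using norm_inner_le_norm (𝕜 := 𝕜) (((‖u‖⁻¹ : ℝ) : 𝕜) • u) v.1
  refine le_ciSup hbdd ⟨merge t a b, tRank_merge ?_ ?_, ?_⟩
  · rintro rfl; simp at ha
  · rintro rfl; simp at hb
  · rw [norm_merge, ha, hb, one_mul]

theorem tau_le {t : Finset ι} {r n : ℕ} (hn : n ≤ r) {w : HilbertTensor 𝕜 H}
    (hw : IsMergeSum t n w) (u : HilbertTensor 𝕜 H) : tau t r u ≤ ‖u - w‖ := by
  have hbdd : BddBelow (Set.range fun v : {v : HilbertTensor 𝕜 H // tRank t v ≤ r} =>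
      ‖u - v‖) := ⟨0, by rintro _ ⟨v, rfl⟩; exact norm_nonneg _⟩
  exact ciInf_le hbdd ⟨w, hw.tRank_le.trans (by exact_mod_cast hn)⟩

section Iteration

variable {t : Finset ι} {B : HilbertTensor 𝕜 H →L[𝕜] HilbertTensor 𝕜 H} {R : ℕ}
  {S : Fin R → (InPart 𝕜 H t →L[𝕜] InPart 𝕜 H t)}
  {T : Fin R → (OutPart 𝕜 H t →L[𝕜] OutPart 𝕜 H t)} {e : HilbertTensor 𝕜 H} {q θ : ℝ}

theorem one_le_of_isLUB_overlaps (hB : IsTensorSum t B S T) (hq : 0 ≤ q) (he : ‖e‖ = 1)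
    (hBe : B e = e) (hB0 : ∀ v, inner 𝕜 e v = 0 → inner 𝕜 e (B v) = 0)
    (hBq : ∀ v, inner 𝕜 e v = 0 → ‖B v‖ ≤ q * ‖v‖) (hθ : IsLUB (overlaps t e) θ) (hθ0 : 0 < θ)
    (k : ℕ) : 1 ≤ (R : ℝ) ^ k * θ ^ 2 + (q ^ 2 * R) ^ k := by
  have hle : θ ≤ √((R : ℝ) ^ k * θ ^ 2 * (θ ^ 2 + (q ^ k) ^ 2)) := by
    refine hθ.2 ?_
    rintro _ ⟨a, b, ha, hb, rfl⟩
    refine Real.le_sqrt_of_sq_le ?_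
    obtain ⟨h1, h2⟩ := iterate_contraction hq he hBe hB0 hBq
      (v := merge t a b) (by rw [norm_merge, ha, hb, one_mul]) k
    rw [← h1] at h2
    have h3 := norm_sq_le_of_norm_sub_le he h2
    have h4 := ((isMergeSum_merge t a b).iterate hB k).norm_inner_sq_le
      (norm_inner_merge_le hθ.1)
    have h5 := norm_inner_merge_le hθ.1 a b
    rw [ha, hb, one_mul, mul_one] at h5
    rw [h1] at h3 h4
    refine h4.trans ?_
    push_cast
    rw [one_mul]
    gcongr
    refine h3.trans ?_
    gcongr
  -- Now `θ² ≤ R^k θ² (θ² + q^(2k))`, and the positive factor `θ²` cancels.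
  rw [Real.le_sqrt hθ0.le (by positivity)] at hle
  have h6 : θ ^ 2 * 1 ≤ θ ^ 2 * ((R : ℝ) ^ k * θ ^ 2 + (q ^ 2 * R) ^ k) := by
    refine (mul_one _).trans_le (hle.trans_eq ?_)
    rw [mul_pow, ← pow_mul, ← pow_mul, mul_comm k 2]
    ring
  exact le_of_mul_le_mul_left h6 (by positivity)

/-- Each nonzero overlap `c` gives an approximation with error at most `s q^k / |c|`. Read as `|c| ≤
q^k s / τ` for `τ > 0`, this is an upper bound for all overlaps and hence for `θ`. -/
theorem tau_mul_le (hB : IsTensorSum t B S T) (hq : 0 ≤ q) (he : ‖e‖ = 1)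
    (hBe : B e = e) (hB0 : ∀ v, inner 𝕜 e v = 0 → inner 𝕜 e (B v) = 0)
    (hBq : ∀ v, inner 𝕜 e v = 0 → ‖B v‖ ≤ q * ‖v‖) (hθ : IsLUB (overlaps t e) θ)
    {k r : ℕ} (hr : R ^ k ≤ r) {s : ℝ} (hs : 0 ≤ s) :
    tau t r ((s : 𝕜) • e) * θ ≤ q ^ k * s := by
  have hτ : 0 ≤ tau t r ((s : 𝕜) • e) := Real.iInf_nonneg fun _ => norm_nonneg _
  rcases hτ.eq_or_lt with h0 | hpos
  · rw [← h0, zero_mul]; positivity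
  rw [mul_comm, ← le_div_iff₀ hpos]
  refine hθ.2 ?_
  rintro _ ⟨a, b, ha, hb, rfl⟩
  rw [le_div_iff₀ hpos]
  set c : 𝕜 := inner 𝕜 e (merge t a b) with hc
  rcases eq_or_ne c 0 with h | h
  · rw [h]; simp; positivity
  obtain ⟨-, h2⟩ := iterate_contraction hq he hBe hB0 hBq
    (v := merge t a b) (by rw [norm_merge, ha, hb, one_mul]) k
  rw [← hc] at h2
  have hc0 : 0 < ‖c‖ := norm_pos_iff.2 h
  -- The factor `s / c` turns the limit direction `c e` of the iteration into `s e`.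
  have h3 := tau_le (by simpa using hr)
    (((isMergeSum_merge t a b).iterate hB k).smul ((s : 𝕜) * c⁻¹)) ((s : 𝕜) • e)
  have h4 : (s : 𝕜) • e - ((s : 𝕜) * c⁻¹) • B^[k] (merge t a b) =
      -(((s : 𝕜) * c⁻¹) • (B^[k] (merge t a b) - c • e)) := by
    rw [smul_sub, smul_smul, mul_assoc, inv_mul_cancel₀ h, mul_one, neg_sub]
  rw [h4, norm_neg, norm_smul, norm_mul, RCLike.norm_ofReal, abs_of_nonneg hs, norm_inv] at h3
  calc ‖c‖ * tau t r ((s : 𝕜) • e)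
      ≤ ‖c‖ * (s * ‖c‖⁻¹ * q ^ k) := by
        gcongr
        exact h3.trans (by gcongr)
    _ = q ^ k * s := by field_simp

end Iteration

end HilbertTensor

/-! ### Choice of the number of iterations, and the theorem -/

/-- For `R > 1` the exponent `s` satisfies `R^s = 1/q`, so `r ≤ R^(k+1)` becomes `q^(k+1) ≤ r^(-s)`.
The factor `1/q` is the price of rounding `log_R r` down. -/
theorem exists_pow_le_and_pow_le {R r : ℕ} (hR : 1 ≤ R) (hr : 1 ≤ r) {q : ℝ} (hq0 : 0 < q)
    (hq1 : q < 1) :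
    ∃ k : ℕ, R ^ k ≤ r ∧ q ^ k ≤ 1 / q * (1 / (r : ℝ)) ^ |Real.log q / Real.log R| := by
  -- For `R = 1` the quotient by `Real.log 1 = 0` is `0`, which is the stated convention for the
  -- exponent, and `k = 0` suffices.
  rcases hR.eq_or_lt with rfl | hR
  · refine ⟨0, by simpa using hr, ?_⟩
    simp
    exact (one_le_inv₀ hq0).2 hq1.le
  refine ⟨Nat.log R r, Nat.pow_log_le_self R (by omega), ?_⟩
  have hR' : (1 : ℝ) < R := by exact_mod_cast hR
  have hlR := Real.log_pos hR'
  have hlq := Real.log_neg hq0 hq1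
  have hr0 : (0 : ℝ) < r := by exact_mod_cast hr
  set s := |Real.log q / Real.log R| with hs
  have hs0 : 0 ≤ s := abs_nonneg _
  have hsR : s * Real.log R = -Real.log q := by
    rw [hs, abs_div, abs_of_neg hlq, abs_of_pos hlR]
    field_simp
  have hRs : (R : ℝ) ^ s = q⁻¹ := by
    rw [Real.rpow_def_of_pos (by linarith), mul_comm, hsR, Real.exp_neg, Real.exp_log hq0]
  have h1 : (r : ℝ) ^ s ≤ (q⁻¹) ^ (Nat.log R r + 1) := by
    have h2 : (r : ℝ) ≤ (R : ℝ) ^ (Nat.log R r + 1) := by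
      exact_mod_cast (Nat.lt_pow_succ_log_self hR r).le
    calc (r : ℝ) ^ s ≤ ((R : ℝ) ^ (Nat.log R r + 1)) ^ s := by gcongr
      _ = ((R : ℝ) ^ s) ^ (Nat.log R r + 1) := by
        rw [← Real.rpow_natCast_mul (by linarith), ← Real.rpow_mul_natCast (by linarith),
          mul_comm]
      _ = _ := by rw [hRs]
  have hrs : 0 < (r : ℝ) ^ s := by positivity
  rw [one_div (r : ℝ), Real.inv_rpow hr0.le, one_div, ← mul_inv, le_inv_comm₀ (by positivity)
    (by positivity), ← inv_pow]
  calc q * (r : ℝ) ^ s ≤ q * (q⁻¹) ^ (Nat.log R r + 1) := by gcongr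
    _ = _ := by rw [pow_succ']; field_simp

/-- Taking logarithms, `k log x ≤ -log 2` is a lower bound on `k` because `log x < 0`. The quotient
is positive, so the natural ceiling is the usual one. -/
theorem pow_ceil_le_half {x : ℝ} (hx0 : 0 < x) (hx1 : x < 1) :
    x ^ ⌈-Real.log 2 / Real.log x⌉₊ ≤ 1 / 2 := by
  have hl := Real.log_neg hx0 hx1
  have h := Nat.le_ceil (-Real.log 2 / Real.log x)
  rw [div_le_iff_of_neg hl] at h
  rw [← Real.log_le_log_iff (by positivity) (by norm_num), Real.log_pow, one_div, Real.log_inv]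
  exact h

theorem theorem4 {𝕜 : Type*} [RCLike 𝕜] {d : ℕ} {H : Fin d → Type*}
    [∀ i, NormedAddCommGroup (H i)] [∀ i, InnerProductSpace 𝕜 (H i)]
    [∀ i, CompleteSpace (H i)]
    (t : Finset (Fin d)) (ht_pos : 0 < t.card) (ht_lt : t.card < d)
    -- the bounded self-adjoint operator, its simple smallest eigenvalue and the spectral gap
    (A : HilbertTensor 𝕜 H →L[𝕜] HilbertTensor 𝕜 H) (hA : IsSelfAdjoint A)
    (lam₁ lam₂ Γ : ℝ) (h_gap : lam₁ < lam₂) (h_lt : lam₂ < Γ)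
    (h_bounds : ∀ v : HilbertTensor 𝕜 H,
      lam₁ * ‖v‖ ^ 2 ≤ RCLike.re (inner 𝕜 v (A v)) ∧
        RCLike.re (inner 𝕜 v (A v)) ≤ Γ * ‖v‖ ^ 2)
    (h_simple : Module.finrank 𝕜
      (Module.End.eigenspace (A : HilbertTensor 𝕜 H →ₗ[𝕜] HilbertTensor 𝕜 H) (lam₁ : 𝕜)) = 1)
    (h_spec : spectrum 𝕜 A \ {(lam₁ : 𝕜)} ⊆ (fun x : ℝ => (x : 𝕜)) '' Set.Icc lam₂ Γ)
    (u : HilbertTensor 𝕜 H) (hu : u ≠ 0) (hAu : A u = (lam₁ : 𝕜) • u)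
    -- the low-rank representation of the operator
    (rA : ℕ) (S : Fin rA → (HilbertTensor.InPart 𝕜 H t →L[𝕜] HilbertTensor.InPart 𝕜 H t))
    (T : Fin rA → (HilbertTensor.OutPart 𝕜 H t →L[𝕜] HilbertTensor.OutPart 𝕜 H t))
    (h_rep : HilbertTensor.IsTensorSum t A S T)
    (R : ℕ) (hR : R = rA + 1 ∨ (R = rA ∧ ∃ i, S i = 1 ∨ T i = 1))
    (Δ q : ℝ) (hΔ : Δ = (lam₂ - lam₁) / (Γ - lam₁)) (hq : q = (1 - Δ) / (1 + Δ))
    (hqR : q ^ 2 * R < 1) :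
    1 / 2 * (1 / (R : ℝ)) ^ ⌈-Real.log 2 / Real.log (q ^ 2 * R)⌉₊ ≤
        HilbertTensor.theta t u ^ 2 ∧
      ∀ r : ℕ, 1 ≤ r →
        HilbertTensor.tau t r u ≤
          √2 * (R : ℝ) ^ ((1 / 2 : ℝ) * (⌈-Real.log 2 / Real.log (q ^ 2 * R)⌉₊ : ℝ)) *
            (‖u‖ / q) * (1 / (r : ℝ)) ^ |Real.log q / Real.log R| := by
  have hGl : 0 < Γ - lam₁ := by linarith
  -- In this form `q` is the contraction factor of the Richardson operator.
  have hq' : q = (Γ - lam₂) / (lam₂ + Γ - 2 * lam₁) := by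
    have h2 : 1 - Δ = (Γ - lam₂) / (Γ - lam₁) := by rw [hΔ]; field_simp; ring
    have h3 : 1 + Δ = (lam₂ + Γ - 2 * lam₁) / (Γ - lam₁) := by rw [hΔ]; field_simp; ring
    rw [hq, h2, h3, div_div_div_cancel_right₀ hGl.ne']
  have hq0 : 0 < q := by rw [hq']; exact div_pos (by linarith) (by linarith)
  have hq1 : q < 1 := by rw [hq', div_lt_one (by linarith)]; linarith
  have hR1 : 1 ≤ R := by
    rcases hR with rfl | ⟨rfl, i, -⟩
    · omega
    · exact Nat.one_le_of_lt i.2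
  have hR0 : (0 : ℝ) < R := by exact_mod_cast hR1
  have hgap : ∀ a : ℝ, lam₁ < a → a < lam₂ → (a : 𝕜) ∉ spectrum 𝕜 A := by
    intro a h1 h2 ha
    obtain ⟨b, hb, hba⟩ := h_spec ⟨ha, fun h => h1.ne' (RCLike.ofReal_injective h)⟩
    have hba' : b = a := RCLike.ofReal_injective hba
    linarith [hb.1]
  have hsym : (A : HilbertTensor 𝕜 H →ₗ[𝕜] HilbertTensor 𝕜 H).IsSymmetric := hA.isSymmetric
  obtain ⟨S', T', hB⟩ := h_rep.exists_smul_one_sub_smul hR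
    ((1 + 2 / (lam₂ + Γ - 2 * lam₁) * lam₁ : ℝ) : 𝕜) ((2 / (lam₂ + Γ - 2 * lam₁) : ℝ) : 𝕜)
  change HilbertTensor.IsTensorSum t (richardson A lam₁ (2 / (lam₂ + Γ - 2 * lam₁))) S' T' at hB
  have hun : 0 < ‖u‖ := norm_pos_iff.2 hu
  set e : HilbertTensor 𝕜 H := ((‖u‖⁻¹ : ℝ) : 𝕜) • u with he
  have hen : ‖e‖ = 1 := by
    rw [he, norm_smul, RCLike.norm_ofReal, abs_of_nonneg (by positivity), inv_mul_cancel₀ hun.ne']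
  have he0 : e ≠ 0 := norm_pos_iff.1 (by rw [hen]; exact one_pos)
  have hue : ((‖u‖ : ℝ) : 𝕜) • e = u := by
    rw [he, smul_smul, ← RCLike.ofReal_mul, mul_inv_cancel₀ hun.ne', RCLike.ofReal_one, one_smul]
  have hAe : A e = (lam₁ : 𝕜) • e := by rw [he, map_smul, hAu, smul_comm]
  have hBe := richardson_apply_of_eigenvector (2 / (lam₂ + Γ - 2 * lam₁)) hAe
  have hB0 : ∀ v, inner 𝕜 e v = 0 →
      inner 𝕜 e (richardson A lam₁ (2 / (lam₂ + Γ - 2 * lam₁)) v) = 0 :=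
    fun v hv => inner_richardson_eq_zero hsym hAe hv
  have hBq : ∀ v, inner 𝕜 e v = 0 →
      ‖richardson A lam₁ (2 / (lam₂ + Γ - 2 * lam₁)) v‖ ≤ q * ‖v‖ := fun v hv => by
    rw [hq']
    exact norm_richardson_apply_le hA h_gap h_lt (fun v => (h_bounds v).1)
      (fun v => (h_bounds v).2) h_simple hgap he0 hAe hv
  obtain ⟨θ, hθ0, hθ⟩ := HilbertTensor.exists_isLUB_overlaps t he0
  set K := ⌈-Real.log 2 / Real.log (q ^ 2 * R)⌉₊ with hK
  have hhalf : (q ^ 2 * R) ^ K ≤ 1 / 2 := pow_ceil_le_half (by positivity) hqR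
  have hone := HilbertTensor.one_le_of_isLUB_overlaps hB hq0.le hen hBe hB0 hBq hθ hθ0 K
  have hRK : (0 : ℝ) < (R : ℝ) ^ K := by positivity
  have hθK : 1 / 2 * (1 / (R : ℝ)) ^ K ≤ θ ^ 2 := by
    rw [one_div_pow, mul_one_div, div_le_iff₀ hRK]
    linarith
  refine ⟨hθK.trans (pow_le_pow_left₀ hθ0.le (HilbertTensor.le_theta hθ) 2), fun r hr => ?_⟩
  obtain ⟨k, hk, hqk⟩ := exists_pow_le_and_pow_le hR1 hr hq0 hq1
  have hτ := HilbertTensor.tau_mul_le hB hq0.le hen hBe hB0 hBq hθ hk (norm_nonneg u)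
  rw [hue] at hτ
  -- This is the square root of `1 ≤ 2 R^K θ²`; it trades the factor `θ` in `hτ` for the constant of
  -- the claim.
  have hθinv : 1 ≤ √2 * (R : ℝ) ^ ((1 / 2 : ℝ) * (K : ℝ)) * θ := by
    have h1 : (√2 * (R : ℝ) ^ ((1 / 2 : ℝ) * (K : ℝ)) * θ) ^ 2 = 2 * (R : ℝ) ^ K * θ ^ 2 := by
      rw [mul_pow, mul_pow, Real.sq_sqrt (by norm_num), ← Real.rpow_mul_natCast hR0.le]
      congr 2
      rw [← Real.rpow_natCast]
      congr 1
      push_cast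
      ring
    have h2 : (1 : ℝ) ^ 2 ≤ (√2 * (R : ℝ) ^ ((1 / 2 : ℝ) * (K : ℝ)) * θ) ^ 2 := by
      rw [h1]; linarith
    exact (pow_le_pow_iff_left₀ zero_le_one (by positivity) two_ne_zero).1 h2
  set X := √2 * (R : ℝ) ^ ((1 / 2 : ℝ) * (K : ℝ))
  have hτ0 : 0 ≤ HilbertTensor.tau t r u := Real.iInf_nonneg fun _ => norm_nonneg _
  calc HilbertTensor.tau t r u ≤ HilbertTensor.tau t r u * (X * θ) :=
        le_mul_of_one_le_right hτ0 hθinv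
    _ = X * (HilbertTensor.tau t r u * θ) := by ring
    _ ≤ X * (q ^ k * ‖u‖) := by gcongr
    _ ≤ X * (1 / q * (1 / (r : ℝ)) ^ |Real.log q / Real.log R| * ‖u‖) := by gcongr
    _ = _ := by ring
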